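/- Let $\mathbb{N}$ be the set of positive integers with the metric $d(n,m)=|n-m|$, and let $\mathbf{I}\mathbb{N}_\infty$ be the monoid, under composition of partial maps written on the right (so $(x)(\gamma\delta)=((x)\gamma)\delta$), of all partial maps $\gamma\colon\mathbb{N}\rightharpoonup\mathbb{N}$ such that $\mathbb{N}\setminus\operatorname{dom}\gamma$ and $\mathbb{N}\setminus\operatorname{ran}\gamma$ are finite and $|(x)\gamma-(y)\gamma|=|x-y|$ for all $x,y\in\operatorname{dom}\gamma$. Let $\mathscr{C}_{\mathbb{N}}$ be the submonoid of $\mathbf{I}\mathbb{N}_\infty$ generated by the maps $\alpha\colon n\mapsto n+1$ (with domain $\mathbb{N}$) and $\beta\colon n\mapsto n-1$ (with domain $\mathbb{N}\setminus\{1\}$); it is isomorphic to the bicyclic monoid. Let $S$ be a submonoid of $\mathbf{I}\mathbb{N}_\infty$ which contains $\mathscr{C}_{\mathbb{N}}$. Let $S_I$ be a semigroup which is the disjoint union $S\sqcup I$ of (a copy of) $S$ as a subsemigroup and a two-sided ideal $I$ of $S_I$, and let $\tau$ be a Hausdorff locally compact topology on $S_I$ such that the multiplication $S_I\times S_I\to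 S_I$ is (jointly) continuous and $I$ is compact. Then $I$ is open in $(S_I,\tau)$. -/

import Mathlib

/-- A partial cofinite isometry of the positive integers: a partial injection of `ℕ+`, with
cofinite domain and cofinite range, which preserves the usual distance `|n - m|`. -/
@[ext]
structure CofiniteIsometry where
  /-- The underlying partial injection. -/
  toPEquiv : ℕ+ ≃. ℕ+
  isometric : ∀ x y x' y' : ℕ+, toPEquiv x = some x' → toPEquiv y = some y' →
    dist x' y' = dist x y
  cofinite_dom : {x : ℕ+ | toPEquiv x = none}.Finite
  cofinite_ran : {y : ℕ+ | toPEquiv.symm y = none}.Finite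

namespace CofiniteIsometry

theorem finite_trans_none {f g : ℕ+ ≃. ℕ+} (hf : {x : ℕ+ | f x = none}.Finite)
    (hg : {x : ℕ+ | g x = none}.Finite) : {x : ℕ+ | (f.trans g) x = none}.Finite := by
  have h : {x : ℕ+ | (f.trans g) x = none} ⊆
      {x | f x = none} ∪ ⋃ y ∈ {y : ℕ+ | g y = none}, {x | f x = some y} := by
    intro x hx
    rcases hfx : f x with _ | y
    · exact Or.inl hfx
    · refine Or.inr (Set.mem_biUnion (x := y) ?_ hfx)
      have hx' : (f x).bind g = none := hx
      simpa [hfx] using hx'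
  refine (hf.union (hg.biUnion fun y _ => ?_)).subset h
  exact Set.Subsingleton.finite fun a ha b hb => f.inj ha hb

/-- The identity map of `ℕ+`. -/
instance : One CofiniteIsometry where
  one :=
    { toPEquiv := PEquiv.refl ℕ+
      isometric := by
        intro x y x' y' hx hy
        simp only [PEquiv.refl_apply, Option.some.injEq] at hx hy
        rw [hx, hy]
      cofinite_dom := by simp
      cofinite_ran := by simp }

/-- Composition of partial maps, written on the right of their arguments:
`(x)(f * g) = ((x)f)g`. -/
instance : Mul CofiniteIsometry where
  mul f g :=
    { toPEquiv := f.toPEquiv.trans g.toPEquiv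
      isometric := by
        intro x y x' y' hx hy
        obtain ⟨a, ha, ha'⟩ := (PEquiv.trans_eq_some _ _ _ _).1 hx
        obtain ⟨b, hb, hb'⟩ := (PEquiv.trans_eq_some _ _ _ _).1 hy
        exact (g.isometric _ _ _ _ ha' hb').trans (f.isometric _ _ _ _ ha hb)
      cofinite_dom := finite_trans_none f.cofinite_dom g.cofinite_dom
      cofinite_ran := finite_trans_none g.cofinite_ran f.cofinite_ran }

/-- The monoid of all partial cofinite isometries of the positive integers. -/
instance : Monoid CofiniteIsometry where
  mul_assoc f g h :=
    CofiniteIsometry.ext (PEquiv.trans_assoc f.toPEquiv g.toPEquiv h.toPEquiv)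
  one_mul f := CofiniteIsometry.ext (PEquiv.refl_trans f.toPEquiv)
  mul_one f := CofiniteIsometry.ext (PEquiv.trans_refl f.toPEquiv)

/-- The shift `n ↦ n + 1` with domain `ℕ+` and range `ℕ+ \ {1}`. -/
def alpha : CofiniteIsometry where
  toPEquiv :=
    { toFun := fun n => some (n + 1)
      invFun := fun n => if n = 1 then none else some (n - 1)
      inv := by
        intro a b
        by_cases hb : b = 1
        · subst hb
          simpa using (PNat.lt_add_left 1 a).ne'
        · simp only [hb, if_false, Option.some.injEq]
          have h1 : (1 : ℕ+) < b := lt_of_le_of_ne (one_le : 1 ≤ b) (Ne.symm hb)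
          constructor
          · rintro rfl
            rw [add_comm]
            exact PNat.add_sub_of_lt h1
          · rintro rfl
            exact PNat.add_sub }
  isometric := by
    rintro x y _ _ ⟨⟩ ⟨⟩
    simp [PNat.dist_eq]
  cofinite_dom := Set.Finite.subset Set.finite_empty fun _ hx => Option.some_ne_none _ hx
  cofinite_ran := by
    refine (Set.finite_singleton (1 : ℕ+)).subset fun n hn => ?_
    by_contra h
    have hn' : (if n = 1 then none else some (n - 1) : Option ℕ+) = none := hn
    rw [if_neg (show ¬ n = 1 from h)] at hn'
    exact Option.some_ne_none _ hn'

/-- The inverse shift `n ↦ n - 1` with domain `ℕ+ \ {1}` and range `ℕ+`. -/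
def beta : CofiniteIsometry where
  toPEquiv := alpha.toPEquiv.symm
  isometric x y x' y' hx hy :=
    (alpha.isometric x' y' x y ((PEquiv.eq_some_iff _).1 hx) ((PEquiv.eq_some_iff _).1 hy)).symm
  cofinite_dom := alpha.cofinite_ran
  cofinite_ran := alpha.cofinite_dom

/-- The submonoid generated by the two shifts (a copy of the bicyclic monoid). -/
def bicyclic : Submonoid CofiniteIsometry := Submonoid.closure {alpha, beta}

end CofiniteIsometry

/-- `I` is a two-sided ideal of the semigroup `T`. -/
def IsTwoSidedSemigroupIdeal {T : Type*} [Mul T] (I : Set T) : Prop :=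
  ∀ x ∈ I, ∀ t : T, t * x ∈ I ∧ x * t ∈ I

/-! If `I` were not open, then `αⁿ` and `βⁿ` would both accumulate on `I`, although `αⁿβⁿ = 1` stays
outside it. `S` is countable, open and locally compact, so by Baire it has an isolated point;
translations have finite fibres, which makes every point of `S` isolated. A compact neighbourhood
`K` of `I` therefore has only finitely many points outside any open `U ⊇ I`. If `K ∩ S` is finite,
`I` is open. Otherwise `K ∩ S` is stable under translations up to finitely many points, and
`eventually_pow_mem_of_infinite` puts almost all `αⁿ` and `βⁿ` in `K`, hence in every neighbourhood
of `I`. As `I * I ⊆ I` misses `1`, the tube lemma gives a contradiction. What is needed of the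
isometries: each is a translation far out, and is determined up to finitely many choices by its
values on a cofinite set. -/

/-- If a set `A` is stable, up to finitely many exceptions, under the multiplications by `a` on both
sides, and the right translates by powers of `a` leave every point and have finite fibres, then
`A` contains almost all powers of `a` as soon as it is infinite. -/
theorem eventually_pow_mem_of_infinite {M : Type*} [Monoid M] (a : M)
    (hpow : ∀ s : M, ∃ i j : ℕ, a ^ i * s = a ^ j)
    (hfin : ∀ c d : M, {x : M | x * c = d}.Finite)
    (hesc : ∀ e : M, ∃ N : ℕ, ∀ n ≥ N, ∀ s : M, s * a ^ n ≠ e)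
    (A : Set M) (hA : A.Infinite) (hl : {s ∈ A | a * s ∉ A}.Finite)
    (hr : {s ∈ A | s * a ∉ A}.Finite) : ∃ J : ℕ, ∀ j ≥ J, a ^ j ∈ A := by
  have uniform : ∀ E : Set M, E.Finite → ∃ N : ℕ, ∀ n ≥ N, ∀ s : M, s * a ^ n ∉ E := by
    intro E hE
    choose N hN using hesc
    obtain ⟨B, hB⟩ := (hE.image N).bddAbove
    exact ⟨B, fun n hn s hs => hN _ n ((hB ⟨_, hs, rfl⟩).trans hn) s rfl⟩
  obtain ⟨N, hN⟩ := uniform _ hr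
  obtain ⟨N', hN'⟩ := uniform _ hl
  have hbad : (⋃ n ∈ Set.Iio N, ⋃ e ∈ {s ∈ A | s * a ∉ A}, {x : M | x * a ^ n = e}).Finite :=
    (Set.finite_Iio N).biUnion fun n _ => hr.biUnion fun e _ => hfin _ _
  -- From exponent `N` on, `s * a ^ n` avoids the exceptional set for every `s`; the finitely many
  -- smaller exponents each exclude finitely many `s`.
  obtain ⟨s, hsA, hs⟩ := hA.exists_notMem_finite hbad
  have hright : ∀ n : ℕ, s * a ^ n ∈ A := by
    intro n
    induction n with
    | zero => simpa using hsA
    | succ n ih =>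
      by_contra h
      have hE : s * a ^ n ∈ {s ∈ A | s * a ∉ A} := ⟨ih, by rwa [mul_assoc, ← pow_succ]⟩
      have hn : n < N := lt_of_not_ge fun hn => hN n hn s hE
      exact hs (Set.mem_biUnion hn (Set.mem_biUnion hE rfl))
  have hleft : ∀ n ≥ N', ∀ i : ℕ, a ^ i * s * a ^ n ∈ A := by
    intro n hn i
    induction i with
    | zero => simpa using hright n
    | succ i ih =>
      by_contra h
      refine hN' n hn (a ^ i * s) ⟨ih, ?_⟩
      rwa [← mul_assoc, ← mul_assoc, ← pow_succ']
  obtain ⟨i, j, hij⟩ := hpow s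
  refine ⟨j + N', fun m hm => ?_⟩
  have h := hleft (m - j) (by omega) i
  rwa [hij, ← pow_add, Nat.add_sub_cancel' (by omega)] at h

/-! ### Compact ideals in locally compact semigroups -/

theorem isOpen_singleton_of_mem_finite_open {X : Type*} [TopologicalSpace X] [T1Space X]
    {U : Set X} (hU : IsOpen U) (hf : U.Finite) {x : X} (hx : x ∈ U) : IsOpen ({x} : Set X) := by
  have : ({x} : Set X) = U \ (U \ {x}) := by
    rw [Set.sdiff_sdiff_cancel_left (Set.singleton_subset_iff.2 hx)]
  rw [this]
  exact hU.sdiff (hf.subset Set.sdiff_subset).isClosed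

/-- A compact ideal in a locally compact topological semigroup is open if its complement is a
monoid of bicyclic type. -/
theorem isOpen_compact_ideal {M : Type*} [Monoid M] (a b : M) (hab : a * b = 1)
    (hpowl : ∀ s : M, ∃ i j : ℕ, a ^ i * s = a ^ j)
    (hpowr : ∀ s : M, ∃ i j : ℕ, s * b ^ i = b ^ j)
    (hfinl : ∀ c d : M, {x : M | c * x = d}.Finite)
    (hfinr : ∀ c d : M, {x : M | x * c = d}.Finite)
    (hesca : ∀ e : M, ∃ N : ℕ, ∀ n ≥ N, ∀ s : M, s * a ^ n ≠ e)
    (hescb : ∀ e : M, ∃ N : ℕ, ∀ n ≥ N, ∀ s : M, b ^ n * s ≠ e)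
    {T : Type*} [Semigroup T] [TopologicalSpace T] [T2Space T] [LocallyCompactSpace T]
    [ContinuousMul T] (φ : M →ₙ* T) (hφ : Function.Injective φ) (I : Set T)
    (hTI : IsCompl (Set.range φ) I) (hideal : IsTwoSidedSemigroupIdeal I) (hI : IsCompact I) :
    IsOpen I := by
  have hpowmul : ∀ n : ℕ, a ^ n * b ^ n = 1 := by
    intro n
    induction n with
    | zero => simp
    | succ n ih => rw [pow_succ, pow_succ', mul_assoc, ← mul_assoc a, hab, one_mul, ih]
  have hcount : Countable M := by
    rw [← Set.countable_univ_iff]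
    refine (Set.countable_iUnion fun i : ℕ => Set.countable_iUnion fun j : ℕ =>
      (hfinl (a ^ i) (a ^ j)).countable).mono fun s _ => ?_
    obtain ⟨i, j, h⟩ := hpowl s
    exact Set.mem_iUnion.2 ⟨i, Set.mem_iUnion.2 ⟨j, h⟩⟩
  have hcompl : Set.range φ = Iᶜ := hTI.eq_compl
  have hopen : IsOpen (Set.range φ) := hcompl ▸ hI.isClosed.isOpen_compl
  -- The preimage of an isolated point under a translation is open and meets the range of `φ` in a
  -- finite set.
  have isolated_left : ∀ c x : M, IsOpen {φ (c * x)} → IsOpen {φ x} := by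
    intro c x h
    have hO := (h.preimage (continuous_const_mul (φ c))).inter hopen
    refine isOpen_singleton_of_mem_finite_open hO
      (((hfinl c (c * x)).image φ).subset ?_) ⟨by simp, x, rfl⟩
    rintro _ ⟨hy, y, rfl⟩
    exact ⟨y, hφ (by simpa using hy), rfl⟩
  have isolated_right : ∀ c x : M, IsOpen {φ (x * c)} → IsOpen {φ x} := by
    intro c x h
    have hO := (h.preimage (continuous_mul_const (φ c))).inter hopen
    refine isOpen_singleton_of_mem_finite_open hO
      (((hfinr c (x * c)).image φ).subset ?_) ⟨by simp, x, rfl⟩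
    rintro _ ⟨hy, y, rfl⟩
    exact ⟨y, hφ (by simpa using hy), rfl⟩
  have hisol : ∃ s, IsOpen {φ s} := by
    have : LocallyCompactSpace (Set.range φ) := hopen.locallyCompactSpace
    have : Nonempty (Set.range φ) := ⟨⟨φ 1, 1, rfl⟩⟩
    have : Countable (Set.range φ) := (Set.countable_range φ).to_subtype
    -- Baire category: a countable union of closed singletons covers the space, so one of them has
    -- interior.
    obtain ⟨y, x, hx⟩ := nonempty_interior_of_iUnion_of_closed
      (f := fun x : Set.range φ => ({x} : Set (Set.range φ)))
      (fun _ => isClosed_singleton) (Set.iUnion_of_singleton _)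
    obtain rfl : x = y := Set.mem_singleton_iff.1 (interior_subset hx)
    obtain ⟨s, hs⟩ := x.2
    refine ⟨s, ?_⟩
    have h : IsOpen ({x} : Set (Set.range φ)) :=
      interior_eq_iff_isOpen.1 (interior_subset.antisymm (Set.singleton_subset_iff.2 hx))
    simpa [hs] using hopen.isOpenMap_subtype_val _ h
  have hdisc : ∀ s, IsOpen {φ s} := by
    obtain ⟨s₀, h₀⟩ := hisol
    have h1 : IsOpen {φ 1} := isolated_left s₀ 1 (by rwa [mul_one])
    intro s
    obtain ⟨i, j, h⟩ := hpowl s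
    -- `a ^ i * s * b ^ j = a ^ j * b ^ j = 1`, which is isolated.
    refine isolated_left (a ^ i) s (isolated_right (b ^ j) _ ?_)
    rwa [h, hpowmul]
  obtain ⟨K, hK, hIK⟩ := exists_compact_superset hI
  have hsmall : ∀ U : Set T, IsOpen U → I ⊆ U → {s : M | φ s ∈ K ∧ φ s ∉ U}.Finite := by
    intro U hU hIU
    have hKU : IsCompact (K \ U) := hK.diff hU
    obtain ⟨t, ht⟩ := hKU.elim_finite_subcover (fun s : M => ({φ s} : Set T)) hdisc (by
      intro x hx
      have : x ∈ Set.range φ := hcompl ▸ fun h => hx.2 (hIU h)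
      obtain ⟨s, rfl⟩ := this
      exact Set.mem_iUnion.2 ⟨s, rfl⟩)
    refine t.finite_toSet.subset fun s hs => ?_
    obtain ⟨u, hu, h⟩ := Set.mem_iUnion₂.1 (ht hs)
    exact hφ h ▸ hu
  by_cases hA : {s : M | φ s ∈ K}.Finite
  · have : I = interior K \ (φ '' {s : M | φ s ∈ K}) := by
      ext x
      constructor
      · rintro hx
        refine ⟨hIK hx, ?_⟩
        rintro ⟨s, -, rfl⟩
        have : φ s ∈ Iᶜ := hcompl ▸ Set.mem_range_self s
        exact this hx
      · rintro ⟨hx, hx'⟩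
        by_contra h
        obtain ⟨s, rfl⟩ : x ∈ Set.range φ := hcompl ▸ h
        exact hx' ⟨s, interior_subset (s := K) hx, rfl⟩
    rw [this]
    exact isOpen_interior.sdiff (hA.image φ).isClosed
  exfalso
  -- The preimage of `interior K` under a translation is an open set containing the ideal, so
  -- `hsmall` bounds the exceptions.
  have hl : ∀ c : M, {s ∈ {s : M | φ s ∈ K} | c * s ∉ {s : M | φ s ∈ K}}.Finite := by
    intro c
    refine (hsmall _ (isOpen_interior.preimage (continuous_const_mul (φ c)))
      fun x hx => hIK (hideal x hx _).1).subset fun s hs => ⟨hs.1, fun h => hs.2 ?_⟩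
    simpa using interior_subset h
  have hr : ∀ c : M, {s ∈ {s : M | φ s ∈ K} | s * c ∉ {s : M | φ s ∈ K}}.Finite := by
    intro c
    refine (hsmall _ (isOpen_interior.preimage (continuous_mul_const (φ c)))
      fun x hx => hIK (hideal x hx _).2).subset fun s hs => ⟨hs.1, fun h => hs.2 ?_⟩
    simpa using interior_subset h
  obtain ⟨J, hJ⟩ := eventually_pow_mem_of_infinite a hpowl hfinr hesca _ hA (hl a) (hr a)
  -- Passing to the opposite monoid exchanges left and right, which gives `b` the role of `a`.
  obtain ⟨J', hJ'⟩ := eventually_pow_mem_of_infinite (MulOpposite.op b)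
    (fun s => by
      obtain ⟨i, j, h⟩ := hpowr s.unop
      exact ⟨i, j, MulOpposite.unop_injective (by simpa using h)⟩)
    (fun c d => ((hfinl c.unop d.unop).image MulOpposite.op).subset fun x hx =>
      ⟨x.unop, by simpa using congrArg MulOpposite.unop hx, rfl⟩)
    (fun e => by
      obtain ⟨N, hN⟩ := hescb e.unop
      exact ⟨N, fun n hn s hs => hN n hn s.unop (by simpa using congrArg MulOpposite.unop hs)⟩)
    (MulOpposite.unop ⁻¹' {s : M | φ s ∈ K})
    (fun h => hA ((h.image MulOpposite.unop).subset fun s hs => ⟨MulOpposite.op s, hs, rfl⟩))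
    (((hr b).image MulOpposite.op).subset fun x hx => ⟨x.unop, hx, rfl⟩)
    (((hl b).image MulOpposite.op).subset fun x hx => ⟨x.unop, hx, rfl⟩)
  obtain ⟨U, V, hU, hV, hIU, hIV, hUV⟩ := generalized_tube_lemma hI hI
    (n := (fun p : T × T => p.1 * p.2) ⁻¹' {φ 1}ᶜ)
    (isClosed_singleton.isOpen_compl.preimage continuous_mul) (by
      rintro ⟨x, y⟩ ⟨hx, -⟩ h
      have h1 : φ 1 ∈ Iᶜ := hcompl ▸ Set.mem_range_self 1
      exact h1 (Set.mem_singleton_iff.1 h ▸ (hideal x hx y).2))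
  have escape : ∀ (c : M), (∀ e : M, ∃ N : ℕ, ∀ n ≥ N, c ^ n ≠ e) →
      ∀ E : Set M, E.Finite → ∃ N : ℕ, ∀ n ≥ N, c ^ n ∉ E := by
    intro c hc E hE
    choose N hN using hc
    obtain ⟨B, hB⟩ := (hE.image N).bddAbove
    exact ⟨B, fun n hn hs => hN _ n ((hB ⟨_, hs, rfl⟩).trans hn) rfl⟩
  obtain ⟨N, hN⟩ := escape a (fun e => (hesca e).imp fun N h n hn => by
    simpa using h n hn 1) _ (hsmall U hU hIU)
  obtain ⟨N', hN'⟩ := escape b (fun e => (hescb e).imp fun N h n hn => by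
    simpa using h n hn 1) _ (hsmall V hV hIV)
  obtain ⟨n, h1, h2, h3, h4⟩ : ∃ n, J ≤ n ∧ J' ≤ n ∧ N ≤ n ∧ N' ≤ n :=
    ⟨J + J' + N + N', by omega, by omega, by omega, by omega⟩
  have ha : φ (a ^ n) ∈ U := by
    by_contra h
    exact hN n h3 ⟨hJ n h1, h⟩
  have hb : φ (b ^ n) ∈ V := by
    by_contra h
    refine hN' n h4 ⟨?_, h⟩
    simpa using hJ' n h2
  refine hUV (Set.mk_mem_prod ha hb) ?_
  simp only [Set.mem_singleton_iff]
  rw [← map_mul, hpowmul]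

/-! ### Algebra of partial cofinite isometries -/

namespace CofiniteIsometry

theorem mul_eq_some {f g : CofiniteIsometry} {x z : ℕ+} :
    (f * g).toPEquiv x = some z ↔ ∃ y, f.toPEquiv x = some y ∧ g.toPEquiv y = some z :=
  PEquiv.trans_eq_some _ _ _ _

theorem ext_some {f g : CofiniteIsometry}
    (h : ∀ x y, f.toPEquiv x = some y ↔ g.toPEquiv x = some y) : f = g :=
  CofiniteIsometry.ext (PEquiv.ext fun x => Option.ext fun y => h x y)

/-- The inverse partial isometry. -/
def inverse (f : CofiniteIsometry) : CofiniteIsometry where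
  toPEquiv := f.toPEquiv.symm
  isometric x y x' y' hx hy :=
    (f.isometric x' y' x y ((PEquiv.eq_some_iff _).1 hx) ((PEquiv.eq_some_iff _).1 hy)).symm
  cofinite_dom := f.cofinite_ran
  cofinite_ran := f.cofinite_dom

theorem inverse_inverse (f : CofiniteIsometry) : f.inverse.inverse = f := rfl

theorem inverse_alpha : alpha.inverse = beta := rfl

theorem inverse_mul (f g : CofiniteIsometry) : (f * g).inverse = g.inverse * f.inverse :=
  CofiniteIsometry.ext (PEquiv.symm_trans_rev f.toPEquiv g.toPEquiv)

theorem inverse_pow (f : CofiniteIsometry) (n : ℕ) : (f ^ n).inverse = f.inverse ^ n := by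
  induction n with
  | zero => rfl
  | succ n ih => rw [pow_succ, inverse_mul, ih, pow_succ']

theorem alpha_eq_some {x y : ℕ+} : alpha.toPEquiv x = some y ↔ (y : ℕ) = x + 1 := by
  have : alpha.toPEquiv x = some (x + 1) := rfl
  rw [this, Option.some.injEq, ← PNat.coe_inj]
  simp [eq_comm]

theorem alpha_pow_eq_some {n : ℕ} {x y : ℕ+} :
    (alpha ^ n).toPEquiv x = some y ↔ (y : ℕ) = x + n := by
  induction n generalizing y with
  | zero =>
    have : (alpha ^ 0).toPEquiv x = some x := rfl
    rw [this, Option.some.injEq, ← PNat.coe_inj]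
    simp [eq_comm]
  | succ n ih =>
    rw [pow_succ, mul_eq_some]
    constructor
    · rintro ⟨z, hz, hy⟩
      rw [ih] at hz
      rw [alpha_eq_some] at hy
      omega
    · intro h
      refine ⟨⟨x + n, by positivity⟩, ih.2 rfl, alpha_eq_some.2 ?_⟩
      simpa [add_assoc] using h

theorem alpha_mul_beta : alpha * beta = 1 := by
  refine ext_some fun x y => ?_
  have h1 : (1 : CofiniteIsometry).toPEquiv x = some x := rfl
  have h2 : (alpha * beta).toPEquiv x = some x :=
    mul_eq_some.2 ⟨x + 1, rfl, (PEquiv.eq_some_iff alpha.toPEquiv).2 rfl⟩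
  rw [h1, h2]

theorem exists_eq_some_of_cofinite (f : CofiniteIsometry) {P : Set ℕ+} (hP : Pᶜ.Finite) :
    ∃ x ∈ P, ∃ y, f.toPEquiv x = some y := by
  obtain ⟨x, hx⟩ := (f.cofinite_dom.union hP).exists_notMem
  simp only [Set.mem_union, Set.mem_ofPred_eq, Set.mem_compl_iff, not_or, not_not] at hx
  exact ⟨x, hx.2, Option.ne_none_iff_exists'.1 hx.1⟩

/-- Beyond its last gap `f` is a translation or a reflection, and a reflection would eventually
leave the positive integers. -/
theorem exists_alpha_pow_mul (f : CofiniteIsometry) : ∃ i j : ℕ, alpha ^ i * f = alpha ^ j := by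
  obtain ⟨N, hN⟩ := f.cofinite_dom.bddAbove
  have hdom : ∀ n : ℕ+, N < n → ∃ m, f.toPEquiv n = some m := fun n hn =>
    Option.ne_none_iff_exists'.1 fun h => (hN h).not_gt hn
  obtain ⟨c, hc⟩ := hdom (N + 1) (PNat.lt_add_right N 1)
  -- Here `c` is the value at `N + 1`. At distance `x + c` from that point the value is `x + 2c` or
  -- `-x`, and the latter is not positive.
  refine ⟨N + 1 + c, 2 * c, ext_some fun x y => ?_⟩
  have hlt : N < x + (N + 1 + c) := by
    rw [← PNat.coe_lt_coe]; push_cast; omega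
  obtain ⟨m, hm⟩ := hdom _ hlt
  have hd := f.isometric _ _ _ _ hm hc
  rw [PNat.dist_eq, PNat.dist_eq] at hd
  have hd' : |(m : ℤ) - c| = |((x : ℤ) + (N + 1 + c)) - (N + 1)| := by
    push_cast at hd
    exact_mod_cast hd
  have hmx : (m : ℕ) = x + 2 * c := by
    have := m.pos
    have := x.pos
    have hp : |((x : ℤ) + (N + 1 + c)) - (N + 1)| = x + c := by
      rw [abs_of_nonneg] <;> [ring; linarith [this, c.pos]]
    rw [hp] at hd'
    rcases abs_choice ((m : ℤ) - c) with h | h <;> omega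
  rw [mul_eq_some, alpha_pow_eq_some]
  constructor
  · rintro ⟨z, hz, hy⟩
    rw [alpha_pow_eq_some] at hz
    have : z = x + (N + 1 + c) := by
      rw [← PNat.coe_inj, hz]; push_cast; rfl
    rw [this, hm, Option.some.injEq] at hy
    rw [← hy, hmx]
  · intro h
    refine ⟨x + (N + 1 + c), alpha_pow_eq_some.2 (by push_cast; rfl), ?_⟩
    rw [hm, Option.some.injEq, ← PNat.coe_inj, hmx, h]

/-- One value `p ↦ q` with `p ∈ P` bounds all others: `x` goes to at most `q + x + p`. This leaves
finitely many options at each of the finitely many points outside `P`. -/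
theorem finite_agree {P : Set ℕ+} (hP : Pᶜ.Finite) (f : CofiniteIsometry) :
    {g : CofiniteIsometry | ∀ x ∈ P, g.toPEquiv x = f.toPEquiv x}.Finite := by
  obtain ⟨p, hp, q, hpq⟩ := f.exists_eq_some_of_cofinite hP
  have : Finite (Pᶜ : Set ℕ+) := hP
  have ht : (Set.univ.pi fun x : (Pᶜ : Set ℕ+) =>
      insert none (some '' Set.Iic (q + x.1 + p : ℕ+))).Finite :=
    Set.Finite.pi fun x => ((Set.finite_Iic _).image _).insert _
  refine Set.Finite.of_injOn (f := fun g (x : (Pᶜ : Set ℕ+)) => g.toPEquiv x)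
    ?_ (fun g hg g' hg' h => ?_) ht
  · intro g hg x _
    rcases hx : g.toPEquiv x with _ | y
    · exact Or.inl hx
    · refine Or.inr ⟨y, ?_, hx.symm⟩
      have hd := g.isometric _ _ _ _ hx ((hg p hp).trans hpq)
      rw [PNat.dist_eq, PNat.dist_eq] at hd
      have hd' : |(y : ℤ) - q| = |((x : ℕ+) : ℤ) - p| := by exact_mod_cast hd
      rw [Set.mem_Iic, ← PNat.coe_le_coe]
      push_cast
      have := p.pos
      have := x.1.pos
      rcases abs_choice ((y : ℤ) - q) with h | h <;>
      rcases abs_choice (((x : ℕ+) : ℤ) - p) with h' | h' <;> omega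
  · refine CofiniteIsometry.ext (PEquiv.ext fun x => ?_)
    by_cases hx : x ∈ P
    · rw [hg x hx, hg' x hx]
    · exact congrFun h ⟨x, hx⟩

/-- The product determines `x` on the range of `c`, which is cofinite. -/
theorem finite_mul_left_eq (c d : CofiniteIsometry) :
    {x : CofiniteIsometry | c * x = d}.Finite := by
  rcases Set.eq_empty_or_nonempty {x : CofiniteIsometry | c * x = d} with h | ⟨f, hf⟩
  · rw [h]; exact Set.finite_empty
  have hP : ({y : ℕ+ | c.toPEquiv.symm y = none}ᶜ)ᶜ.Finite := by
    rw [compl_compl]; exact c.cofinite_ran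
  refine (finite_agree hP f).subset fun g hg x hx => Option.ext fun y => ?_
  obtain ⟨w, hw⟩ := Option.ne_none_iff_exists'.1 hx
  rw [PEquiv.eq_some_iff] at hw
  have key : ∀ k : CofiniteIsometry, (c * k).toPEquiv w = k.toPEquiv x := fun k => by
    change (c.toPEquiv w).bind k.toPEquiv = _
    rw [hw]; rfl
  rw [← key g, ← key f, show c * g = d from hg, show c * f = d from hf]

theorem finite_mul_right_eq (c d : CofiniteIsometry) :
    {x : CofiniteIsometry | x * c = d}.Finite :=
  ((finite_mul_left_eq c.inverse d.inverse).image inverse).subset fun x hx =>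
    ⟨x.inverse, by
      rw [Set.mem_ofPred_eq, ← inverse_mul, show x * c = d from hx], x.inverse_inverse⟩

/-- All values of `s * alpha ^ n` exceed `n`, so a single value of `e` bounds `n`. -/
theorem exists_forall_mul_alpha_pow_ne (e : CofiniteIsometry) :
    ∃ N : ℕ, ∀ n ≥ N, ∀ s : CofiniteIsometry, s * alpha ^ n ≠ e := by
  obtain ⟨x, -, y, hxy⟩ := e.exists_eq_some_of_cofinite (P := Set.univ) (by simp)
  refine ⟨y, fun n hn s hs => ?_⟩
  rw [← hs, mul_eq_some] at hxy
  obtain ⟨z, -, hz⟩ := hxy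
  rw [alpha_pow_eq_some] at hz
  have := z.pos
  omega

theorem exists_mul_beta_pow (f : CofiniteIsometry) : ∃ i j : ℕ, f * beta ^ i = beta ^ j := by
  -- Inversion is an anti-automorphism exchanging `alpha` and `beta`.
  obtain ⟨i, j, h⟩ := f.inverse.exists_alpha_pow_mul
  refine ⟨i, j, ?_⟩
  have := congrArg inverse h
  rwa [inverse_mul, inverse_inverse, inverse_pow, inverse_pow, inverse_alpha] at this

theorem exists_forall_beta_pow_mul_ne (e : CofiniteIsometry) :
    ∃ N : ℕ, ∀ n ≥ N, ∀ s : CofiniteIsometry, beta ^ n * s ≠ e := by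
  obtain ⟨N, hN⟩ := e.inverse.exists_forall_mul_alpha_pow_ne
  refine ⟨N, fun n hn s hs => hN n hn s.inverse ?_⟩
  rw [← hs, inverse_mul, ← inverse_alpha, ← inverse_pow, inverse_inverse]

end CofiniteIsometry

/-- `T` is the semigroup `S ⊔ I`: the embedding `φ` identifies `S` with a subsemigroup of `T`
whose complement is the ideal `I`. -/
theorem corollary3p16 (S : Submonoid CofiniteIsometry) (hS : CofiniteIsometry.bicyclic ≤ S)
    {T : Type*} [Semigroup T] [TopologicalSpace T] [T2Space T] [LocallyCompactSpace T]
    [ContinuousMul T] (φ : S →ₙ* T) (hφ : Function.Injective φ) (I : Set T)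
    (hTI : IsCompl (Set.range φ) I) (hideal : IsTwoSidedSemigroupIdeal I) (hI : IsCompact I) :
    IsOpen I := by
  have ha : CofiniteIsometry.alpha ∈ S := hS (Submonoid.subset_closure (by simp))
  have hb : CofiniteIsometry.beta ∈ S := hS (Submonoid.subset_closure (by simp))
  refine isOpen_compact_ideal (⟨_, ha⟩ : S) ⟨_, hb⟩
    (Subtype.ext CofiniteIsometry.alpha_mul_beta) (fun s => ?_) (fun s => ?_) (fun c d => ?_)
    (fun c d => ?_) (fun e => ?_) (fun e => ?_) φ hφ I hTI hideal hI
  · obtain ⟨i, j, h⟩ := s.1.exists_alpha_pow_mul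
    exact ⟨i, j, Subtype.ext h⟩
  · obtain ⟨i, j, h⟩ := s.1.exists_mul_beta_pow
    exact ⟨i, j, Subtype.ext h⟩
  · exact ((CofiniteIsometry.finite_mul_left_eq c d).preimage
      Subtype.val_injective.injOn).subset fun x hx => congrArg Subtype.val hx
  · exact ((CofiniteIsometry.finite_mul_right_eq c d).preimage
      Subtype.val_injective.injOn).subset fun x hx => congrArg Subtype.val hx
  · obtain ⟨N, h⟩ := e.1.exists_forall_mul_alpha_pow_ne
    exact ⟨N, fun n hn s hs => h n hn s.1 (congrArg Subtype.val hs)⟩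
  · obtain ⟨N, h⟩ := e.1.exists_forall_beta_pow_mul_ne
    exact ⟨N, fun n hn s hs => h n hn s.1 (congrArg Subtype.val hs)⟩
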